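/- Let $d\ge 2$ be an integer. For a complex polynomial $P$ of degree $d$, let $\mathrm{Crit}(P)=\{\zeta\in\mathbb C: P'(\zeta)=0\}$ be its set of critical points, and for $z\in\mathbb C\setminus\mathrm{Crit}(P)$ put $$T(P,z)=\max_{\zeta\in\mathrm{Crit}(P)}\left|\frac{P(z)-P(\zeta)}{(z-\zeta)P'(z)}\right|,\qquad L(d)=\inf\{T(P,z): \deg P=d,\ z\in\mathbb C\setminus\mathrm{Crit}(P)\}.$$ Then the following hold. 1. If $P$ is a complex polynomial of degree $d$ and $z\in\mathbb C$ satisfies $P'(z)\ne 0$, then there is a critical point $\zeta$ of $P$ with $$\left|\frac{P(\zeta)-P(z)}{\zeta-z}\right|\ge\frac{|P'(z)|}{d\,4^d}.$$ 2. $L(d)\ge \dfrac{1}{d\,4^d}$. 3. (Normalized form.) If $P$ is a monic complex polynomial of degree $d$ with $P(0)=0$ and $P'(0)\ne 0$, and $\zeta_1,\dots,\zeta_{d-1}$ are its critical points, listed with multiplicity, then $$\max_{1\le j\le d-1}\left|\frac{P(\zeta_j)}{\zeta_j P'(0)}\right|\ge\frac{1}{d\,4^d}.$$ -/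

import Mathlib

namespace DualMeanValue

/-- The set of complex polynomials of degree exactly `d`. -/
def polys (d : ℕ) : Set (Polynomial ℂ) :=
  {P | P.degree = (d : WithBot ℕ)}

/-- The set of critical points of `P`. -/
def crit (P : Polynomial ℂ) : Set ℂ :=
  {ζ | P.derivative.eval ζ = 0}

/-- `Q(P, z, ζ) = (P(z) - P(ζ)) / ((z - ζ) P'(z))`, meant for `z` outside `crit P` and
`ζ` in `crit P`. -/
noncomputable def Q (P : Polynomial ℂ) (z ζ : ℂ) : ℂ :=
  (P.eval z - P.eval ζ) / ((z - ζ) * P.derivative.eval z)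

/-- `T(P, z)`, the maximum of `|Q(P, z, ζ)|` over the critical points `ζ` of `P` (a finite
nonempty set when `P` has degree at least `2`, so that the supremum is a maximum). -/
noncomputable def T (P : Polynomial ℂ) (z : ℂ) : ℝ :=
  sSup ((fun ζ => ‖Q P z ζ‖) '' crit P)

/-- `L(d)`, the infimum of `T(P, z)` over the polynomials `P` of degree `d` and the
points `z` that are not critical points of `P`. -/
noncomputable def L (d : ℕ) : ℝ :=
  sInf {t : ℝ | ∃ P ∈ polys d, ∃ z : ℂ, z ∉ crit P ∧ t = T P z}

end DualMeanValue

open Polynomial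

namespace DualMeanValue

/-! Put `F = P - P(z)`, with leading coefficient `a`, and let `R` be the maximum of `|F|` over the
critical points. All critical points of `F`, and `z`, lie in `{|F| ≤ R}`, which is connected: a
topological change in the sublevel sets above level `R` would need a critical point. A connected
lemniscate projects onto the segment between any two of its points, so Chebyshev's inequality gives
`|a| |ξ - z|^d ≤ 4^d R` for the critical point `ξ` farthest from `z`
(`norm_leadingCoeff_mul_pow_le`). Since `P'(z) = d a ∏ (z - ζ_j)`, also `|P'(z)| ≤ d |a| |ξ -
z|^(d-1)`. Multiplying by `|ζ - z| ≤ |ξ - z|`, where `|F(ζ)| = R`, gives the bound. -/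

/-- The second-order Taylor remainder of a polynomial is continuous in both variables. -/
theorem exists_continuous_quadratic_remainder (P : ℂ[X]) :
    ∃ G : ℂ × ℂ → ℂ, Continuous G ∧ ∀ w h : ℂ,
      P.eval (w + h) = P.eval w + P.derivative.eval w * h + G (w, h) * h ^ 2 := by
  induction P using Polynomial.induction_on with
  | C a => exact ⟨0, continuous_const, by simp⟩
  | add p q hp hq =>
    obtain ⟨G, hG, hG'⟩ := hp
    obtain ⟨H, hH, hH'⟩ := hq
    refine ⟨G + H, hG.add hH, fun w h => ?_⟩
    simp only [eval_add, derivative_add, hG', hH', Pi.add_apply]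
    ring
  | monomial n a ih =>
    obtain ⟨G, hG, hG'⟩ := ih
    refine ⟨fun p => (p.1 + p.2) * G p + (C a * X ^ n).derivative.eval p.1, by fun_prop,
      fun w h => ?_⟩
    have := hG' w h
    rw [pow_succ, ← mul_assoc, derivative_mul, eval_mul, eval_mul (q := X) (x := w), this]
    simp only [eval_add, eval_mul, eval_X, derivative_X, eval_one]
    ring

/-- A closed sublevel set of the modulus of a nonconstant polynomial is compact. -/
theorem isCompact_setOf_norm_eval_le {P : ℂ[X]} (hP : 0 < P.degree) (c : ℝ) :
    IsCompact {w : ℂ | ‖P.eval w‖ ≤ c} := by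
  refine Metric.isCompact_of_isClosed_isBounded
    (isClosed_le (by fun_prop) continuous_const) ?_
  have h : Filter.Tendsto (fun w : ℂ => ‖P.eval w‖) (Bornology.cobounded ℂ) Filter.atTop :=
    P.tendsto_norm_atTop hP tendsto_norm_cobounded_atTop
  have h2 := h.eventually (Filter.eventually_gt_atTop c)
  have h3 : {w : ℂ | ‖P.eval w‖ ≤ c}ᶜ ∈ Bornology.cobounded ℂ := by
    filter_upwards [h2] with w hw
    simpa using hw
  simpa [Bornology.isBounded_def] using h3

/-- A gradient descent step for `‖P‖` that is stationary on the sublevel set of `R` and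
strictly decreases the level `c > R`. -/
theorem exists_descent {P : ℂ[X]} (hP : 0 < P.degree) {R c : ℝ}
    (hR : 0 ≤ R) (hRc : R < c) (hcrit : ∀ w, P.derivative.eval w = 0 → ‖P.eval w‖ ≤ R) :
    ∃ φ : ℂ → ℂ, Continuous φ ∧ (∀ w, ‖P.eval w‖ ≤ R → φ w = w) ∧
      ∀ w, ‖P.eval w‖ ≤ c → ‖P.eval (φ w)‖ < c := by
  obtain ⟨G, hG, hG'⟩ := exists_continuous_quadratic_remainder P
  have hK := isCompact_setOf_norm_eval_le hP c
  obtain ⟨B, hB⟩ := (hK.prod (isCompact_closedBall (0 : ℂ) 1)).exists_bound_of_continuousOn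
    hG.continuousOn
  set η : ℂ → ℝ := fun w => max 0 (‖P.eval w‖ - R) with hη
  have hη0 : ∀ w, 0 ≤ η w := fun w => le_max_left _ _
  have hηc : Continuous η := by fun_prop
  set g : ℂ → ℂ := fun w => η w * P.eval w * starRingEnd ℂ (P.derivative.eval w) with hg
  have hgc : Continuous g := by
    have : Continuous fun w => starRingEnd ℂ (P.derivative.eval w) :=
      Complex.continuous_conj.comp (by fun_prop)
    fun_prop
  set s : ℂ → ℝ := fun w => η w * ‖P.derivative.eval w‖ ^ 2 with hs
  have hsc : Continuous s := by fun_prop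
  have hs0 : ∀ w, 0 ≤ s w := fun w => mul_nonneg (hη0 w) (by positivity)
  have hgs : ∀ w, ‖g w‖ ^ 2 = s w * (η w * ‖P.eval w‖) * ‖P.eval w‖ := fun w => by
    simp only [hg, hs, norm_mul, Complex.norm_real, Real.norm_eq_abs, abs_of_nonneg (hη0 w),
      RCLike.norm_conj]
    ring
  -- One step size `ε` must keep `1 - ε * s w` nonnegative, keep the step in the unit ball where `B`
  -- bounds `G`, and hold the quadratic term to half the linear gain; hence the three nonnegative
  -- summands.
  obtain ⟨A, hA⟩ := hK.exists_bound_of_continuousOn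
    (f := fun w => s w + ‖g w‖ + 2 * |B| * (η w * ‖P.eval w‖)) (by fun_prop)
  have hA' : ∀ w, ‖P.eval w‖ ≤ c → s w + ‖g w‖ + 2 * |B| * (η w * ‖P.eval w‖) ≤ |A| + 1 :=
    fun w hw => by linarith [le_abs_self A, (Real.le_norm_self _).trans (hA w hw)]
  set ε : ℝ := (|A| + 1)⁻¹ with hε
  have hε0 : 0 < ε := by positivity
  have hεA : ε * (|A| + 1) = 1 := inv_mul_cancel₀ (by positivity)
  refine ⟨fun w => w + -(ε * g w), by fun_prop, fun w hw => ?_, fun w hw => ?_⟩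
  · have : η w = 0 := max_eq_left (by linarith)
    simp [hg, this]
  have h1 := hA' w hw
  have hp : 0 ≤ 2 * |B| * (η w * ‖P.eval w‖) :=
    mul_nonneg (by positivity) (mul_nonneg (hη0 w) (norm_nonneg _))
  have hmul : ∀ {x : ℝ}, x ≤ |A| + 1 → ε * x ≤ 1 := fun {x} hx => by
    rw [← hεA]; exact mul_le_mul_of_nonneg_left hx hε0.le
  have e1 : ε * s w ≤ 1 := hmul (by linarith [norm_nonneg (g w)])
  have e2 : ε * ‖g w‖ ≤ 1 := hmul (by linarith [hs0 w])
  have e3 : ε * (2 * |B| * (η w * ‖P.eval w‖)) ≤ 1 :=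
    hmul (by linarith [hs0 w, norm_nonneg (g w)])
  have hn : ‖-((ε : ℂ) * g w)‖ = ε * ‖g w‖ := by
    rw [norm_neg, norm_mul, Complex.norm_real, Real.norm_of_nonneg hε0.le]
  have hGB : ‖G (w, -(ε * g w))‖ ≤ |B| :=
    (hB _ (Set.mk_mem_prod hw (by simpa [hn] using e2))).trans (le_abs_self B)
  have hlin : P.eval w + P.derivative.eval w * -(ε * g w)
      = P.eval w * ((1 - ε * s w : ℝ) : ℂ) := by
    have := Complex.mul_conj' (P.derivative.eval w)
    simp only [hg, hs]
    push_cast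
    rw [← this]
    ring
  have key : ‖P.eval (w + -(ε * g w))‖ ≤ ‖P.eval w‖ * (1 - ε * s w / 2) := by
    rw [hG', hlin]
    refine (norm_add_le _ _).trans ?_
    rw [norm_mul, norm_mul, norm_pow, hn, Complex.norm_real,
      Real.norm_of_nonneg (by linarith : 0 ≤ 1 - ε * s w), mul_pow, hgs]
    have h2 : ‖G (w, -(ε * g w))‖ * (ε ^ 2 * (s w * (η w * ‖P.eval w‖) * ‖P.eval w‖))
        ≤ |B| * (ε ^ 2 * (s w * (η w * ‖P.eval w‖) * ‖P.eval w‖)) := by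
      refine mul_le_mul_of_nonneg_right hGB ?_
      have := hs0 w
      have := hη0 w
      positivity
    have h3 := mul_le_mul_of_nonneg_left e3
      (mul_nonneg (mul_nonneg hε0.le (hs0 w)) (norm_nonneg (P.eval w)))
    nlinarith [h2, h3]
  refine key.trans_lt ?_
  rcases hw.lt_or_eq with h | h
  · refine lt_of_le_of_lt (mul_le_of_le_one_right (norm_nonneg _) ?_) h
    have := mul_nonneg hε0.le (hs0 w)
    linarith
  · have hd : P.derivative.eval w ≠ 0 := fun h0 => by linarith [hcrit w h0]
    have hη' : 0 < η w := lt_max_of_lt_right (by linarith)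
    have : 0 < ε * s w := mul_pos hε0 (mul_pos hη' (by positivity))
    rw [h]
    nlinarith

/-! ### Connectedness of lemniscates -/

/-- The points `x` and `y` lie in complementary relatively clopen pieces of the sublevel set
`{‖P‖ ≤ r}`. -/
def Separated (P : ℂ[X]) (x y : ℂ) (r : ℝ) : Prop :=
  ∃ U V : Set ℂ, IsOpen U ∧ IsOpen V ∧ Disjoint U V ∧ x ∈ U ∧ y ∈ V ∧
    {w : ℂ | ‖P.eval w‖ ≤ r} ⊆ U ∪ V

/-- Compactness: on the part of `{‖P‖ ≤ r + 1}` outside `U ∪ V`, if nonempty, `‖P‖` attains a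
minimum above `r`. -/
theorem Separated.exists_gt {P : ℂ[X]} (hP : 0 < P.degree) {x y : ℂ} {r : ℝ}
    (h : Separated P x y r) : ∃ r' > r, Separated P x y r' := by
  obtain ⟨U, V, hU, hV, hUV, hx, hy, hsub⟩ := h
  have hK : IsCompact ({w : ℂ | ‖P.eval w‖ ≤ r + 1} \ (U ∪ V)) :=
    (isCompact_setOf_norm_eval_le hP _).diff (hU.union hV)
  rcases ({w : ℂ | ‖P.eval w‖ ≤ r + 1} \ (U ∪ V)).eq_empty_or_nonempty with he | hne
  · exact ⟨r + 1, by simp, U, V, hU, hV, hUV, hx, hy, Set.sdiff_eq_empty.mp he⟩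
  · obtain ⟨m, hm, hmin⟩ := hK.exists_isMinOn hne
      (f := fun w => ‖P.eval w‖) (by fun_prop)
    have hrm : r < ‖P.eval m‖ := not_le.mp fun h => hm.2 (hsub h)
    have hm1 : ‖P.eval m‖ ≤ r + 1 := hm.1
    refine ⟨(r + ‖P.eval m‖) / 2, by simp only [gt_iff_lt]; linarith, U, V, hU, hV, hUV, hx, hy,
      fun w hw => ?_⟩
    by_contra hn
    have hw' : ‖P.eval w‖ ≤ (r + ‖P.eval m‖) / 2 := hw
    have : ‖P.eval m‖ ≤ ‖P.eval w‖ := hmin ⟨show ‖P.eval w‖ ≤ r + 1 by linarith, hn⟩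
    linarith

/-- A sublevel set of `‖P‖` containing all critical points of `P` is connected. -/
theorem not_separated {P : ℂ[X]} (hP : 0 < P.degree) {R : ℝ} (hR : 0 ≤ R)
    (hcrit : ∀ w, P.derivative.eval w = 0 → ‖P.eval w‖ ≤ R) {x y : ℂ}
    (hx : ‖P.eval x‖ ≤ R) (hy : ‖P.eval y‖ ≤ R) : ¬ Separated P x y R := by
  intro hsep
  set S : Set ℝ := {r | R ≤ r ∧ Separated P x y r} with hS
  have hRS : R ∈ S := ⟨le_rfl, hsep⟩
  -- Once the level exceeds `‖P‖` on the segment from `x` to `y`, that segment joins them in the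
  -- sublevel set.
  have hbdd : BddAbove S := by
    have hseg : IsCompact (segment ℝ x y) := by
      rw [segment_eq_image_lineMap]
      exact isCompact_Icc.image (by fun_prop)
    obtain ⟨M, hM⟩ := hseg.exists_bound_of_continuousOn (f := fun w => P.eval w) (by fun_prop)
    refine ⟨M, fun r hr => ?_⟩
    obtain ⟨-, U, V, hU, hV, hUV, hxU, hyV, hsub⟩ := hr
    by_contra! hlt
    have hc : IsPreconnected (segment ℝ x y) := (convex_segment x y).isPreconnected
    obtain ⟨w, -, hwU, hwV⟩ := hc U V hU hV (fun w hw => hsub ((hM w hw).trans hlt.le))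
      ⟨x, left_mem_segment ℝ x y, hxU⟩ ⟨y, right_mem_segment ℝ x y, hyV⟩
    exact Set.disjoint_left.mp hUV hwU hwV
  set c := sSup S with hc
  have hRc : R ≤ c := le_csSup hbdd hRS
  have hnc : ¬ Separated P x y c := fun h => by
    obtain ⟨r', hr', h'⟩ := h.exists_gt hP
    exact absurd (le_csSup hbdd ⟨hRc.trans hr'.le, h'⟩) (not_le.mpr hr')
  have hRc' : R < c := hRc.lt_of_ne fun h => hnc (h ▸ hsep)
  obtain ⟨φ, hφ, hfix, hdesc⟩ := exists_descent hP hR hRc' hcrit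
  obtain ⟨m, hm, hmax⟩ := (isCompact_setOf_norm_eval_le hP c).exists_isMaxOn
    ⟨x, hx.trans hRc⟩ (f := fun w => ‖P.eval (φ w)‖) (by fun_prop)
  obtain ⟨r, ⟨-, U, V, hU, hV, hUV, hxU, hyV, hsub⟩, hr⟩ :=
    exists_lt_of_lt_csSup ⟨R, hRS⟩ (hdesc m hm)
  -- `φ` sends the level `c` set into the level `r` set and fixes `x` and `y`, so the separation at
  -- `r` pulls back to `c`.
  refine hnc ⟨φ ⁻¹' U, φ ⁻¹' V, hU.preimage hφ, hV.preimage hφ, hUV.preimage φ, ?_, ?_,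
    fun w hw => ?_⟩
  · simpa [hfix x hx] using hxU
  · simpa [hfix y hy] using hyV
  · exact hsub ((hmax hw).trans hr.le)

/-! ### Diameter of a connected lemniscate -/

/-- Chebyshev's inequality on `[0, 1]`, in a non-sharp form. -/
theorem one_le_four_pow_mul_of_forall_abs_eval_le {q : ℝ[X]} (hq : q.Monic) {M : ℝ}
    (hM : ∀ t ∈ Set.Icc (0 : ℝ) 1, |q.eval t| ≤ M) : 1 ≤ 4 ^ q.natDegree * M := by
  have hM0 : 0 < M := by
    by_contra! h
    refine hq.ne_zero (eq_zero_of_infinite_isRoot q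
      ((Set.Icc_infinite zero_lt_one).mono fun t ht => ?_))
    exact abs_eq_zero.mp (le_antisymm ((hM t ht).trans h) (abs_nonneg _))
  set l : ℝ[X] := C (1 / 2) * X + C (1 / 2) with hl
  have hl1 : l.natDegree = 1 := natDegree_linear (by norm_num)
  have hlc : l.leadingCoeff = 1 / 2 := leadingCoeff_linear (by norm_num)
  have hdeg : (C M⁻¹ * q.comp l).natDegree = q.natDegree := by
    rw [natDegree_C_mul (inv_ne_zero hM0.ne'), natDegree_comp, hl1, mul_one]
  have h := Chebyshev.leadingCoeff_le_of_forall_abs_le_one (n := q.natDegree)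
    (P := C M⁻¹ * q.comp l) (natDegree_le_iff_degree_le.mp hdeg.le) fun x hx => by
      have := hM (1 / 2 * x + 1 / 2) ⟨by linarith [hx.1], by linarith [hx.2]⟩
      simp only [hl, eval_mul, eval_C, eval_comp, eval_add, eval_X, abs_mul, abs_inv,
        abs_of_pos hM0]
      rw [inv_mul_le_iff₀ hM0]
      linarith
  rw [leadingCoeff_mul, leadingCoeff_C, leadingCoeff_comp (by rw [hl1]; norm_num), hq, hlc,
    one_mul, inv_mul_le_iff₀ hM0, one_div, inv_pow, inv_le_iff_one_le_mul₀ (by positivity)] at h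
  have h2 : (2 : ℝ) ^ (q.natDegree - 1) ≤ 2 ^ q.natDegree :=
    pow_le_pow_right₀ one_le_two (Nat.sub_le _ _)
  calc 1 ≤ M * 2 ^ (q.natDegree - 1) * 2 ^ q.natDegree := h
    _ ≤ M * 2 ^ q.natDegree * 2 ^ q.natDegree := by gcongr
    _ = 4 ^ q.natDegree * M := by
      rw [mul_assoc, ← mul_pow, mul_comm]; norm_num

/-- The distance between two points of a connected lemniscate is at most four times its
capacity. -/
theorem norm_leadingCoeff_mul_pow_le {P : ℂ[X]} (hP : 0 < P.degree) {R : ℝ} (hR : 0 ≤ R)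
    (hcrit : ∀ w, P.derivative.eval w = 0 → ‖P.eval w‖ ≤ R) {x y : ℂ}
    (hx : ‖P.eval x‖ ≤ R) (hy : ‖P.eval y‖ ≤ R) :
    ‖P.leadingCoeff‖ * ‖y - x‖ ^ P.natDegree ≤ 4 ^ P.natDegree * R := by
  rcases eq_or_ne y x with rfl | hxy
  · have : P.natDegree ≠ 0 := (natDegree_pos_iff_degree_pos.mpr hP).ne'
    simp only [sub_self, norm_zero, zero_pow this, mul_zero]
    positivity
  have hb : y - x ≠ 0 := sub_ne_zero.mpr hxy
  have hlc : P.leadingCoeff ≠ 0 := leadingCoeff_ne_zero.mpr (ne_zero_of_degree_gt hP)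
  -- If the projection missed `t`, the two half-planes beside that line would separate `x` from `y`.
  have hproj : ∀ t ∈ Set.Icc (0 : ℝ) 1, ∃ w, ‖P.eval w‖ ≤ R ∧ ((w - x) / (y - x)).re = t := by
    intro t ht
    by_contra! hne
    have ht0 : 0 < t := ht.1.lt_of_ne fun h => hne x hx (by simp [← h])
    have ht1 : t < 1 := ht.2.lt_of_ne fun h => hne y hy (by simp [h, div_self hb])
    have hcont : Continuous fun w : ℂ => ((w - x) / (y - x)).re :=
      Complex.continuous_re.comp (by fun_prop)
    refine not_separated hP hR hcrit hx hy ⟨{w | ((w - x) / (y - x)).re < t},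
      {w | t < ((w - x) / (y - x)).re}, isOpen_lt hcont continuous_const,
      isOpen_lt continuous_const hcont, ?_, ?_, ?_, fun w hw => ?_⟩
    · exact Set.disjoint_left.mpr fun w h1 h2 => lt_asymm (Set.mem_ofPred_eq ▸ h1) h2
    · simpa using ht0
    · simpa [div_self hb] using ht1
    · exact lt_or_gt_of_ne (hne w hw)
  have hsplit : P.Splits := IsAlgClosed.splits P
  set σ : ℂ → ℝ := fun r => ((r - x) / (y - x)).re with hσ
  -- Projecting the roots onto the line shortens each factor `‖w - r‖`, so `q` inherits the bound on
  -- `P`.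
  set q : ℝ[X] := (P.roots.map fun r => X - C (σ r)).prod with hq
  have hqm : q.Monic := monic_multiset_prod_of_monic _ _ fun r _ => monic_X_sub_C _
  have hqd : q.natDegree = P.natDegree := by
    rw [hq, natDegree_multiset_prod_of_monic _ (by
      intro f hf
      obtain ⟨r, -, rfl⟩ := Multiset.mem_map.mp hf
      exact monic_X_sub_C _), Multiset.map_map, hsplit.natDegree_eq_card_roots]
    simp
  have hpos : 0 < ‖P.leadingCoeff‖ * ‖y - x‖ ^ P.natDegree := by positivity
  have hM : ∀ t ∈ Set.Icc (0 : ℝ) 1,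
      |q.eval t| ≤ R / (‖P.leadingCoeff‖ * ‖y - x‖ ^ P.natDegree) := by
    intro t ht
    obtain ⟨w, hw, hwt⟩ := hproj t ht
    rw [le_div_iff₀ hpos]
    refine le_trans ?_ hw
    rw [hsplit.eval_eq_prod_roots, norm_mul, mul_left_comm,
      hsplit.natDegree_eq_card_roots, hq, eval_multiset_prod, Multiset.map_map]
    refine mul_le_mul_of_nonneg_left ?_ (norm_nonneg _)
    induction P.roots using Multiset.induction with
    | empty => simp
    | cons r s ih =>
      simp only [Multiset.map_cons, Multiset.prod_cons, Multiset.card_cons, abs_mul, norm_mul,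
        pow_succ]
      calc _ = (|eval t (X - C (σ r))| * ‖y - x‖) *
            (|(s.map (eval t ∘ fun r => X - C (σ r))).prod| * ‖y - x‖ ^ s.card) := by
              simp only [Function.comp_def]; ring
        _ ≤ _ := by
          refine mul_le_mul ?_ ih (by positivity) (norm_nonneg _)
          have h1 : eval t (X - C (σ r)) = ((w - r) / (y - x)).re := by
            simp only [eval_sub, eval_X, eval_C, hσ, ← hwt]
            rw [← Complex.sub_re, ← sub_div]
            congr 2
            ring
          rw [h1, ← le_div_iff₀ (norm_pos_iff.mpr hb), ← norm_div]
          exact Complex.abs_re_le_norm _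
  have := one_le_four_pow_mul_of_forall_abs_eval_le hqm hM
  rwa [hqd, ← mul_div_assoc, le_div_iff₀ hpos, one_mul] at this

/-! ### The dual mean value estimate -/

theorem crit_finite {P : ℂ[X]} {d : ℕ} (hd : 2 ≤ d) (hP : P ∈ polys d) : (crit P).Finite := by
  have h : P.derivative ≠ 0 := fun h => by
    have h1 := derivative_eq_zero.mp h
    have h2 : P.natDegree = d := natDegree_eq_of_degree_eq_some hP
    omega
  refine (P.derivative.roots.toFinset.finite_toSet).subset fun w hw => ?_
  simpa [h] using show P.derivative.eval w = 0 from hw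

theorem exists_crit_le_norm_div {d : ℕ} (hd : 2 ≤ d) {P : ℂ[X]} (hP : P ∈ polys d) {z : ℂ}
    (hz : z ∉ crit P) : ∃ ζ ∈ crit P,
      ‖P.derivative.eval z‖ / ((d : ℝ) * 4 ^ d) ≤ ‖(P.eval ζ - P.eval z) / (ζ - z)‖ := by
  have hnd : P.natDegree = d := natDegree_eq_of_degree_eq_some hP
  have hdeg : P.derivative.natDegree = d - 1 := by rw [natDegree_derivative, hnd]
  have hne : (crit P).Nonempty := by
    obtain ⟨w, hw⟩ := IsAlgClosed.exists_root P.derivative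
      (natDegree_pos_iff_degree_pos.mp (by omega)).ne'
    exact ⟨w, hw⟩
  have hfin := crit_finite hd hP
  -- `ζ` fixes the level of the lemniscate and `ξ` its extent; the two may differ.
  obtain ⟨ζ, hζ, hmax⟩ := hfin.exists_maximalFor (fun w => ‖P.eval w - P.eval z‖) _ hne
  obtain ⟨ξ, hξ, hfar⟩ := hfin.exists_maximalFor (fun w => ‖w - z‖) _ hne
  have hmax' : ∀ w ∈ crit P, ‖P.eval w - P.eval z‖ ≤ ‖P.eval ζ - P.eval z‖ := fun w hw =>
    (le_total _ _).elim id (hmax hw)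
  have hfar' : ∀ w ∈ crit P, ‖w - z‖ ≤ ‖ξ - z‖ := fun w hw =>
    (le_total _ _).elim id (hfar hw)
  refine ⟨ζ, hζ, ?_⟩
  set F : ℂ[X] := P - C (P.eval z) with hF
  have hFd : F.natDegree = d := by rw [hF, natDegree_sub_C, hnd]
  have hFlc : F.leadingCoeff = P.leadingCoeff := by
    rw [leadingCoeff, leadingCoeff, hFd, hnd, hF, coeff_sub, coeff_C, if_neg (by omega), sub_zero]
  have hFe : ∀ w, F.eval w = P.eval w - P.eval z := by simp [hF]
  have hF' : F.derivative = P.derivative := by simp [hF]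
  have hdist := norm_leadingCoeff_mul_pow_le (P := F) (R := ‖P.eval ζ - P.eval z‖) (x := z)
    (y := ξ) (natDegree_pos_iff_degree_pos.mp (by omega)) (norm_nonneg _)
    (fun w hw => by rw [hFe]; exact hmax' w (by rwa [hF'] at hw))
    (by simp [hFe]) (by rw [hFe]; exact hmax' ξ hξ)
  rw [hFd, hFlc] at hdist
  have hζz : ζ - z ≠ 0 := sub_ne_zero.mpr fun h => hz (h ▸ hζ)
  have hsplit : P.derivative.Splits := IsAlgClosed.splits _
  have hprod : ‖(P.derivative.roots.map (z - ·)).prod‖ ≤ ‖ξ - z‖ ^ (d - 1) := by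
    rw [← hdeg, hsplit.natDegree_eq_card_roots]
    have hr : ∀ w ∈ P.derivative.roots, ‖z - w‖ ≤ ‖ξ - z‖ := fun w hw => by
      rw [norm_sub_rev]; exact hfar' w (isRoot_of_mem_roots hw)
    generalize P.derivative.roots = s at hr
    induction s using Multiset.induction with
    | empty => simp
    | cons r s ih =>
      rw [Multiset.map_cons, Multiset.prod_cons, norm_mul, Multiset.card_cons, pow_succ']
      exact mul_le_mul (hr r (Multiset.mem_cons_self r s))
        (ih fun w hw => hr w (Multiset.mem_cons_of_mem hw)) (norm_nonneg _) (norm_nonneg _)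
  have hlc : ‖P.derivative.leadingCoeff‖ = d * ‖P.leadingCoeff‖ := by
    rw [leadingCoeff, hdeg, coeff_derivative, Nat.sub_add_cancel (by omega), leadingCoeff, hnd,
      mul_comm, norm_mul]
    congr 1
    rw [Nat.cast_sub (by omega)]
    simp
  have hd0 : (0 : ℝ) < d := by positivity
  rw [norm_div, div_le_div_iff₀ (by positivity) (norm_pos_iff.mpr hζz),
    hsplit.eval_eq_prod_roots, norm_mul, hlc]
  calc _ ≤ d * ‖P.leadingCoeff‖ * ‖ξ - z‖ ^ (d - 1) * ‖ξ - z‖ := by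
        gcongr
        exact hfar' ζ hζ
    _ = d * (‖P.leadingCoeff‖ * ‖ξ - z‖ ^ d) := by
        rw [mul_assoc _ (‖ξ - z‖ ^ (d - 1)), ← pow_succ, Nat.sub_add_cancel (by omega), mul_assoc]
    _ ≤ d * (4 ^ d * ‖P.eval ζ - P.eval z‖) := by gcongr
    _ = _ := by ring

theorem le_T {d : ℕ} (hd : 2 ≤ d) {P : ℂ[X]} (hP : P ∈ polys d) {z : ℂ} (hz : z ∉ crit P) :
    1 / ((d : ℝ) * 4 ^ d) ≤ T P z := by
  obtain ⟨ζ, hζ, h⟩ := exists_crit_le_norm_div hd hP hz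
  have hz' : 0 < ‖P.derivative.eval z‖ := norm_pos_iff.mpr hz
  refine le_trans ?_ (le_csSup ((crit_finite hd hP).image _).bddAbove (Set.mem_image_of_mem _ hζ))
  rw [Q, ← div_div (P.eval z - P.eval ζ), norm_div, le_div_iff₀ hz', ← neg_sub, ← neg_sub ζ, neg_div_neg_eq]
  rwa [one_div_mul_eq_div]

end DualMeanValue

theorem theorem1 (d : ℕ) (hd : 2 ≤ d) :
    (∀ P ∈ DualMeanValue.polys d, ∀ z : ℂ, z ∉ DualMeanValue.crit P →
      ∃ ζ ∈ DualMeanValue.crit P,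
        ‖P.derivative.eval z‖ / ((d : ℝ) * 4 ^ d) ≤ ‖(P.eval ζ - P.eval z) / (ζ - z)‖) ∧
    1 / ((d : ℝ) * 4 ^ d) ≤ DualMeanValue.L d ∧
    (∀ P ∈ DualMeanValue.polys d, P.Monic → P.eval 0 = 0 → P.derivative.eval 0 ≠ 0 →
      ∀ ζ : Fin (d - 1) → ℂ, P.derivative.roots = Multiset.map ζ Finset.univ.val →
        1 / ((d : ℝ) * 4 ^ d) ≤ ⨆ j, ‖P.eval (ζ j) / (ζ j * P.derivative.eval 0)‖) := by
  refine ⟨fun P hP z hz => DualMeanValue.exists_crit_le_norm_div hd hP hz, ?_, ?_⟩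
  · refine le_csInf ⟨_, X ^ d, degree_X_pow d, 1, ?_, rfl⟩ ?_
    · simp only [DualMeanValue.crit, Set.mem_ofPred_eq, derivative_X_pow, eval_mul, eval_C,
        eval_pow, eval_X, one_pow, mul_one]
      exact Nat.cast_ne_zero.mpr (by omega)
    · rintro _ ⟨P, hP, z, hz, rfl⟩
      exact DualMeanValue.le_T hd hP hz
  · intro P hP _ h0 h0' ζ hζ
    obtain ⟨w, hw, h⟩ := DualMeanValue.exists_crit_le_norm_div hd hP (z := 0) h0'
    have hne : P.derivative ≠ 0 := fun h => h0' (by simp [h])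
    have hmem : w ∈ P.derivative.roots := (mem_roots hne).mpr hw
    rw [hζ] at hmem
    obtain ⟨j, -, rfl⟩ := Multiset.mem_map.mp hmem
    refine le_trans ?_ (le_ciSup (Set.finite_range _).bddAbove j)
    rw [← div_div (P.eval (ζ j)), norm_div, le_div_iff₀ (norm_pos_iff.mpr h0'), one_div_mul_eq_div]
    simpa [h0] using h
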